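/- Let $G$ be a complete graph on a finite vertex set $V$, each of whose edges is labeled $+$ or $-$; let $N^+(v)$ and $N^-(v)$ be the sets of vertices joined to $v$ by a $+$ edge and by a $-$ edge. A fractional clustering of $G$ is a symmetric function $x$ on pairs of vertices with $x_{uv}\in[0,1]$, $x_{uu}=0$ and $x_{vz}\le x_{vw}+x_{wz}$ for all $v,w,z$. Its error vector is $$\mathrm{err}(x)_v=\sum_{w\in N^+(v)}x_{vw}+\sum_{w\in N^-(v)}(1-x_{vw}).$$ For a clustering $\mathcal C$, i.e. a partition of $V$, put $\mathrm{err}(\mathcal C)=\mathrm{err}(x^{\mathcal C})$, where $x^{\mathcal C}_{uv}=0$ if $u,v$ lie in the same part and $x^{\mathcal C}_{uv}=1$ otherwise. Given $x$ and parameters $0<\gamma<\alpha<1/2$, the rounding algorithm starts with $S=V$ and repeats the following while $S\ne\emptyset$. For $u\in S$ let $T_u=\{w\in S\setminus\{u\}: x_{uw}\le\alpha\}$ and $T^*_u=\{w\in S\setminus\{u\}: x_{uw}\le\gamma\}$. Choose a pivot $u\in S$ maximizing $|T^*_u|$ (ties broken arbitrarily). If $\sum_{w\in T_u}x_{uw}\ge\alpha|T_u|/2$,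 output the cluster $\{u\}$ and remove $u$ from $S$; otherwise output the cluster $\{u\}\cup T_u$ and remove it from $S$. Theorem. There is a constant $c=c(\alpha,\gamma)>0$, depending only on $\alpha$ and $\gamma$, such that for every $0<\gamma<\alpha<1/2$, every finite complete graph $G$ with $\pm$ edge labels and every fractional clustering $x$ of $G$, the rounding algorithm can be run to completion, and for every possible run (every choice among tied pivots) the clusters output form a partition $\mathcal C$ of $V$ with $$\mathrm{err}(\mathcal C)_v\le c\,\mathrm{err}(x)_v\qquad\text{for every } v\in V.$$ Consequently $f(\mathrm{err}(\mathcal C))\le c\, f(\mathrm{err}(x))$ for every $f:\mathbb R_{\ge0}^V\to\mathbb R$ such that $f(ty)\le t f(y)$ for all $t\ge0$, $y\in\mathbb R_{\ge0}^V$, and $f(y)\le f(z)$ whenever $y,z\in\mathbb R_{\ge0}^V$ satisfy $y_v\le z_v$ for all $v$. Moreover, for $\alpha=0.465744$ and $\gamma=0.0887449$ one can take $c\le 48$. -/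

import Mathlib

universe u

namespace CorrClust

variable {V : Type u}

/-- A fractional clustering of the vertex set `V`: a `[0,1]`-valued vector indexed by pairs of
vertices satisfying the triangle inequality, with the convention `x u u = 0`. -/
structure FracClustering (V : Type u) where
  dist : V → V → ℝ
  self_eq_zero : ∀ v, dist v v = 0
  symm : ∀ v w, dist v w = dist w v
  nonneg : ∀ v w, 0 ≤ dist v w
  le_one : ∀ v w, dist v w ≤ 1
  triangle : ∀ v w z, dist v z ≤ dist v w + dist w z

section Errors

variable [Fintype V] [DecidableEq V]

/-- A labeled complete graph on `V` is given by the graph `E` of its `+` edges; its `-` edges are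
the edges of the complement `Eᶜ`.  The error vector of a fractional clustering `x`:
`err(x)_v = ∑_{w ∈ N⁺(v)} x_{vw} + ∑_{w ∈ N⁻(v)} (1 - x_{vw})`. -/
def errVec (E : SimpleGraph V) [DecidableRel E.Adj] (x : FracClustering V) (v : V) : ℝ :=
  ∑ w ∈ E.neighborFinset v, x.dist v w + ∑ w ∈ Eᶜ.neighborFinset v, (1 - x.dist v w)

/-- The fractional clustering with coordinates in `{0,1}` associated to a (discrete) clustering,
that is, to a partition of the vertex set. -/
def ofPartition (C : Finpartition (Finset.univ : Finset V)) : FracClustering V where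
  dist v w := if C.part v = C.part w then 0 else 1
  self_eq_zero v := by simp
  symm v w := by simp only [eq_comm]
  nonneg v w := by split_ifs <;> norm_num
  le_one v w := by split_ifs <;> norm_num
  triangle v w z := by
    by_cases h₁ : C.part v = C.part w
    · simp [h₁]
    · simp only [h₁, if_false]
      split_ifs <;> norm_num

end Errors

section Algorithm

variable [DecidableEq V]

/-- The candidate set `{w ∈ S - {p} : x_{pw} ≤ r}`; it is `T_p` for `r = α` and `T*_p` for
`r = γ`. -/
noncomputable def cand (x : FracClustering V) (r : ℝ) (S : Finset V) (p : V) : Finset V :=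
  {w ∈ S.erase p | x.dist p w ≤ r}

/-- `p` is an admissible pivot for the set `S` of remaining vertices: it lies in `S` and maximizes
`|T*_p|` over `S`. Ties may be broken arbitrarily. -/
def IsPivot (x : FracClustering V) (γ : ℝ) (S : Finset V) (p : V) : Prop :=
  p ∈ S ∧ ∀ w ∈ S, (cand x γ S w).card ≤ (cand x γ S p).card

/-- `Run x α γ S L`: started with the set `S` of remaining vertices, the rounding algorithm with
thresholds `α, γ` can (for some choice among tied pivots) output exactly the clusters in the list
`L`, in this order, and halt. -/
inductive Run (x : FracClustering V) (α γ : ℝ) : Finset V → List (Finset V) → Prop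
  /-- The loop ends when no vertex remains. -/
  | halt : Run x α γ ∅ []
  /-- A Type 1 cluster `{p}` is output. -/
  | type1 (S : Finset V) (L : List (Finset V)) (p : V) (hp : IsPivot x γ S p)
      (hT : α * ((cand x α S p).card : ℝ) / 2 ≤ ∑ w ∈ cand x α S p, x.dist p w)
      (rest : Run x α γ (S \ {p}) L) : Run x α γ S ({p} :: L)
  /-- A Type 2 cluster `{p} ∪ T_p` is output. -/
  | type2 (S : Finset V) (L : List (Finset V)) (p : V) (hp : IsPivot x γ S p)
      (hT : ∑ w ∈ cand x α S p, x.dist p w < α * ((cand x α S p).card : ℝ) / 2)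
      (rest : Run x α γ (S \ ({p} ∪ cand x α S p)) L) :
      Run x α γ S (({p} ∪ cand x α S p) :: L)

end Algorithm

/-- The assumptions on an objective `f : ℝⁿ_{≥0} → ℝ`: `f (c y) ≤ c f y` for `c ≥ 0`, and
monotonicity. Values of `f` outside the nonnegative orthant are irrelevant. -/
structure GoodObjective (f : (V → ℝ) → ℝ) : Prop where
  scale : ∀ c : ℝ, 0 ≤ c → ∀ y : V → ℝ, (∀ v, 0 ≤ y v) → f (c • y) ≤ c * f y
  mono : ∀ y z : V → ℝ, (∀ v, 0 ≤ y v) → (∀ v, 0 ≤ z v) → (∀ v, y v ≤ z v) → f y ≤ f z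

end CorrClust

open Finset

namespace CorrClust

variable {V : Type u}

/-! Fix `δ ≤ γ` with `δ < α/2`. Whenever a cluster is removed, the disagreements it settles at `v`
are charged to the fractional error of `v` on pairs being removed. A `-` edge inside a cluster, or a
cut `+` edge longer than `δ`, pays for itself with factor `B`; the edges from an outside `v` to a
Type 2 cluster are paid for together (`sum_cross_le`).

What remains are cut `+` edges of length at most `δ`. If `v` belongs to a Type 2 cluster around `u`,
such an edge forces `v` near the border, while `T_u` is on average within `α/2` of `u`. If instead
`v` is within `δ` of a singleton pivot `u`, then `T_u` is on average at least `α/2` away from `u`.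
Either way the error of `v` on `T_u` is at least `(α/2 - δ)|T_u|`, and pivot maximality bounds the
number of short edges at `v` by `|T_u|`. Each situation is charged once with factor `ρ = 1/(α/2 -
δ)`, so the ratio is `B + 2ρ`. -/

theorem FracClustering.triangle' (x : FracClustering V) (u v w : V) :
    x.dist v w ≤ x.dist u v + x.dist u w := by
  have h := x.triangle v u w
  rwa [x.symm v u] at h

theorem FracClustering.dist_le_add (x : FracClustering V) (u v w : V) :
    x.dist u w ≤ x.dist u v + x.dist v w := x.triangle u v w

theorem FracClustering.dist_le_add' (x : FracClustering V) (u v w : V) :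
    x.dist u v ≤ x.dist u w + x.dist v w := by
  have h := x.triangle u w v
  rwa [x.symm w v] at h

/-- The contribution of the pair `v, w` to the error at `v` of the pair weights `d`. -/
def edgeErr [DecidableEq V] (E : SimpleGraph V) [DecidableRel E.Adj] (d : V → V → ℝ)
    (v w : V) : ℝ :=
  if v = w then 0 else if E.Adj v w then d v w else 1 - d v w

/-- The `0/1` pair weights of a list of clusters: `0` exactly if some cluster contains both. -/
noncomputable def cut [DecidableEq V] (L : List (Finset V)) (v w : V) : ℝ :=
  if ∃ C ∈ L, v ∈ C ∧ w ∈ C then 0 else 1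

/-! ### Pairwise errors and their behaviour when a cluster is split off. -/

section EdgeErr

variable [DecidableEq V] (E : SimpleGraph V) [DecidableRel E.Adj]

theorem errVec_eq_sum [Fintype V] (x : FracClustering V) (v : V) :
    errVec E x v = ∑ w, edgeErr E x.dist v w := by
  have h1 : ∀ w, edgeErr E x.dist v w
      = (if E.Adj v w then x.dist v w else 0) + (if Eᶜ.Adj v w then 1 - x.dist v w else 0) := by
    intro w
    unfold edgeErr
    by_cases hvw : v = w
    · subst hvw; simp
    · by_cases ha : E.Adj v w <;> simp [ha, hvw]
  simp only [h1, sum_add_distrib, ← sum_filter, errVec]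
  congr 1 <;> (apply sum_congr _ (fun _ _ => rfl); ext w; simp)

variable {E}

theorem edgeErr_nonneg (x : FracClustering V) (v w : V) : 0 ≤ edgeErr E x.dist v w := by
  unfold edgeErr
  have := x.nonneg v w
  have := x.le_one v w
  split_ifs <;> linarith

theorem edgeErr_le_one {d : V → V → ℝ} {v w : V} (h0 : 0 ≤ d v w) (h1 : d v w ≤ 1) :
    edgeErr E d v w ≤ 1 := by
  unfold edgeErr
  split_ifs <;> linarith

/-- For a `+` edge this is the triangle inequality. For a `-` edge, `1 - x_vw ≥ 1 - x_uv - x_uw`,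
and `1 ≥ 2 x_uw`. The label therefore never matters in the averaging arguments over `T_u`. -/
theorem dist_sub_dist_le_edgeErr (x : FracClustering V) {u v w : V} (hw : x.dist u w ≤ 1 / 2) :
    x.dist u w - x.dist u v ≤ edgeErr E x.dist v w := by
  unfold edgeErr
  have := x.dist_le_add u v w
  have := x.triangle' u v w
  split_ifs with h
  · simp [h]
  all_goals linarith

theorem dist_sub_dist_le_edgeErr' (x : FracClustering V) {u v w : V} (hv : x.dist u v ≤ 1 / 2) :
    x.dist u v - x.dist u w ≤ edgeErr E x.dist v w := by
  unfold edgeErr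
  have := x.dist_le_add' u v w
  have := x.triangle' u v w
  split_ifs with h
  · simp [h]
  all_goals linarith

theorem edgeErr_cut_of_mem {L : List (Finset V)} {C S : Finset V}
    (hL : ∀ D ∈ L, D ⊆ S \ C) {v w : V} (hv : v ∈ C) :
    edgeErr E (cut (C :: L)) v w = edgeErr E (fun _ w => if w ∈ C then 0 else 1) v w := by
  have h : (∃ D ∈ C :: L, v ∈ D ∧ w ∈ D) ↔ w ∈ C := by
    constructor
    · rintro ⟨D, hD, hvD, hwD⟩
      rcases List.mem_cons.1 hD with rfl | hD
      · exact hwD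
      · exact absurd hv (mem_sdiff.1 (hL D hD hvD)).2
    · exact fun hw => ⟨C, by simp, hv, hw⟩
  simp only [edgeErr, cut, h]

theorem edgeErr_cut_of_notMem {L : List (Finset V)} {C : Finset V} {v : V} (hv : v ∉ C) (w : V) :
    edgeErr E (cut (C :: L)) v w = edgeErr E (cut L) v w := by
  have h : (∃ D ∈ C :: L, v ∈ D ∧ w ∈ D) ↔ ∃ D ∈ L, v ∈ D ∧ w ∈ D := by simp [hv]
  have hcut : cut (C :: L) v w = cut L v w := if_congr h rfl rfl
  simp only [edgeErr, hcut]

theorem edgeErr_cut_of_mem_of_notMem {L : List (Finset V)} {C S : Finset V}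
    (hL : ∀ D ∈ L, D ⊆ S \ C) {v w : V} (hv : v ∉ C) (hw : w ∈ C) :
    edgeErr E (cut (C :: L)) v w = if E.Adj v w then 1 else 0 := by
  have h : ¬ ∃ D ∈ C :: L, v ∈ D ∧ w ∈ D := by
    rintro ⟨D, hD, hvD, hwD⟩
    rcases List.mem_cons.1 hD with rfl | hD
    · exact hv hvD
    · exact absurd hw (mem_sdiff.1 (hL D hD hwD)).2
  have hvw : v ≠ w := by rintro rfl; exact hv hw
  simp only [edgeErr, cut, if_neg h, if_neg hvw, sub_self]

end EdgeErr

/-! ### Runs terminate and output partitions. -/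

section Structure

variable [DecidableEq V] {x : FracClustering V} {α γ r : ℝ} {S : Finset V} {L : List (Finset V)}

theorem mem_cand {p w : V} : w ∈ cand x r S p ↔ (w ≠ p ∧ w ∈ S) ∧ x.dist p w ≤ r := by
  simp [cand]

theorem cand_mono {r' : ℝ} {S' : Finset V} (hr : r ≤ r') (hS : S ⊆ S') (p : V) :
    cand x r S p ⊆ cand x r' S' p := by
  intro w
  simp only [mem_cand]
  exact fun h => ⟨⟨h.1.1, hS h.1.2⟩, h.2.trans hr⟩

theorem cluster_subset {p : V} (hp : p ∈ S) : {p} ∪ cand x r S p ⊆ S := by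
  intro w hw
  rcases mem_union.1 hw with hw | hw
  · rwa [mem_singleton.1 hw]
  · exact (mem_cand.1 hw).1.2

theorem Run.subset (h : Run x α γ S L) : ∀ C ∈ L, C ⊆ S := by
  induction h with
  | halt => simp
  | type1 S L p hp hT rest ih =>
    intro C hC
    rcases List.mem_cons.1 hC with rfl | hC
    · simpa using hp.1
    · exact (ih C hC).trans sdiff_subset
  | type2 S L p hp hT rest ih =>
    intro C hC
    rcases List.mem_cons.1 hC with rfl | hC
    · exact cluster_subset hp.1
    · exact (ih C hC).trans sdiff_subset

theorem Run.nonempty (h : Run x α γ S L) : ∀ C ∈ L, C.Nonempty := by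
  induction h with
  | halt => simp
  | type1 S L p hp hT rest ih => simpa using ih
  | type2 S L p hp hT rest ih => exact List.forall_mem_cons.2 ⟨⟨p, by simp⟩, ih⟩

theorem Run.exists_mem (h : Run x α γ S L) : ∀ v ∈ S, ∃ C ∈ L, v ∈ C := by
  induction h with
  | halt => simp
  | type1 S L p hp hT rest ih | type2 S L p hp hT rest ih =>
    intro v hv
    rw [List.exists_mem_cons_iff]
    exact or_iff_not_imp_left.2 fun h => ih v (mem_sdiff.2 ⟨hv, h⟩)

theorem Run.pairwise_disjoint (h : Run x α γ S L) : L.Pairwise Disjoint := by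
  induction h with
  | halt => simp
  | type1 S L p hp hT rest ih | type2 S L p hp hT rest ih =>
    exact List.pairwise_cons.2
      ⟨fun D hD => disjoint_sdiff.mono_right (rest.subset D hD), ih⟩

variable (x α γ)

theorem exists_run (S : Finset V) : ∃ L, Run x α γ S L := by
  induction S using Finset.strongInduction with
  | H S ih =>
    rcases S.eq_empty_or_nonempty with rfl | hS
    · exact ⟨[], .halt⟩
    · obtain ⟨p, hpS, hp⟩ := S.exists_max_image (fun w => (cand x γ S w).card) hS
      rcases le_or_gt (α * ((cand x α S p).card : ℝ) / 2) (∑ w ∈ cand x α S p, x.dist p w)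
        with hT | hT
      · obtain ⟨L, hL⟩ := ih (S \ {p}) (sdiff_ssubset (by simpa using hpS) (by simp))
        exact ⟨_, .type1 S L p ⟨hpS, hp⟩ hT hL⟩
      · obtain ⟨L, hL⟩ := ih (S \ ({p} ∪ cand x α S p))
          (sdiff_ssubset (cluster_subset hpS) ⟨p, by simp⟩)
        exact ⟨_, .type2 S L p ⟨hpS, hp⟩ hT hL⟩

variable {x α γ}

theorem Run.exists_finpartition [Fintype V] (h : Run x α γ univ L) :
    ∃ C : Finpartition (univ : Finset V), C.parts.val = (L : Multiset (Finset V)) ∧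
      (ofPartition C).dist = cut L := by
  have hd := h.pairwise_disjoint
  -- Disjointness alone would let `∅` repeat; nonemptiness of the clusters rules this out.
  have hnd : L.Nodup := by
    rw [List.Nodup]
    refine hd.imp_of_mem fun {A B} hA _ hAB hEq => ?_
    subst hEq
    exact (h.nonempty A hA).ne_empty (disjoint_self.1 hAB)
  have hdisj : ∀ A ∈ L, ∀ B ∈ L, A ≠ B → Disjoint A B := fun A hA B hB hAB =>
    hd.forall hA hB hAB
  let C : Finpartition (univ : Finset V) :=
    { parts := ⟨L, hnd⟩
      supIndep := by
        rw [supIndep_iff_pairwiseDisjoint]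
        exact fun A hA B hB hAB => hdisj A hA B hB hAB
      sup_parts := by
        refine eq_univ_of_forall fun v => ?_
        obtain ⟨D, hD, hv⟩ := h.exists_mem v (mem_univ v)
        exact mem_sup.2 ⟨D, hD, hv⟩
      bot_notMem := fun hbot => (h.nonempty ∅ hbot).ne_empty rfl }
  refine ⟨C, rfl, ?_⟩
  ext v w
  have key : C.part v = C.part w ↔ ∃ D ∈ L, v ∈ D ∧ w ∈ D := by
    constructor
    · intro hvw
      refine ⟨C.part v, C.part_mem.2 (mem_univ v), C.mem_part (mem_univ v), ?_⟩
      rw [hvw]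
      exact C.mem_part (mem_univ w)
    · rintro ⟨D, hD, hv, hw⟩
      rw [C.part_eq_of_mem (show D ∈ C.parts from hD) hv,
        C.part_eq_of_mem (show D ∈ C.parts from hD) hw]
  exact if_congr key rfl rfl

end Structure

/-! ### Charging the output error to the fractional error. -/

section Charging

variable [DecidableEq V] {E : SimpleGraph V} [DecidableRel E.Adj] {x : FracClustering V}
  {α γ δ B ρ : ℝ} {S : Finset V} {L : List (Finset V)}

theorem lt_dist_of_notMem_cluster {u v : V} (hv : v ∈ S) (hvC : v ∉ {u} ∪ cand x α S u) :
    α < x.dist u v := by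
  by_contra! hle
  refine hvC (mem_union.2 ?_)
  by_cases hvu : v = u
  · exact .inl (mem_singleton.2 hvu)
  · exact .inr (mem_cand.2 ⟨⟨hvu, hv⟩, hle⟩)

theorem dist_le_of_mem_cluster {u w : V} (hα0 : 0 < α) (hw : w ∈ {u} ∪ cand x α S u) :
    x.dist u w ≤ α := by
  rcases mem_union.1 hw with hw | hw
  · rw [mem_singleton.1 hw, x.self_eq_zero]; exact hα0.le
  · exact (mem_cand.1 hw).2

/-- The error at a pivot that is output as a singleton. -/
theorem sum_singleton_le {u : V} (hα : α ≤ 1 / 2) (hB : 0 ≤ B) (hBα : 1 ≤ B * (α / 2))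
    (hT : α * ((cand x α S u).card : ℝ) / 2 ≤ ∑ w ∈ cand x α S u, x.dist u w) :
    ∑ w ∈ S, edgeErr E (fun _ w => if w ∈ ({u} : Finset V) then 0 else 1) u w
      ≤ B * ∑ w ∈ S, edgeErr E x.dist u w := by
  have hsub : cand x α S u ⊆ S := fun w hw => (mem_cand.1 hw).1.2
  rw [← sum_sdiff hsub, ← sum_sdiff hsub, mul_add]
  refine add_le_add ?_ ?_
  · rw [mul_sum]
    refine sum_le_sum fun w hw => ?_
    obtain ⟨hwS, hw⟩ := mem_sdiff.1 hw
    by_cases huw : u = w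
    · simp [edgeErr, huw]
    · have hx : α < x.dist u w := by
        by_contra! hle
        exact hw (mem_cand.2 ⟨⟨Ne.symm huw, hwS⟩, hle⟩)
      by_cases ha : E.Adj u w
      · simp only [edgeErr, huw, ha, Ne.symm huw, mem_singleton, if_true, if_false]
        nlinarith [x.nonneg u w]
      · have := mul_nonneg hB (edgeErr_nonneg (E := E) x u w)
        simpa [edgeErr, huw, ha, Ne.symm huw] using this
  · have h1 : ∑ w ∈ cand x α S u, edgeErr E (fun _ w => if w ∈ ({u} : Finset V) then 0 else 1) u w
        ≤ (cand x α S u).card := by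
      rw [← nsmul_one, ← sum_const]
      refine sum_le_sum fun w _ => edgeErr_le_one ?_ ?_ <;> split_ifs <;> norm_num
    have h2 : ∑ w ∈ cand x α S u, x.dist u w ≤ ∑ w ∈ cand x α S u, edgeErr E x.dist u w := by
      refine sum_le_sum fun w hw => ?_
      have := dist_sub_dist_le_edgeErr (E := E) x (v := u) ((mem_cand.1 hw).2.trans hα)
      simpa [x.self_eq_zero] using this
    have h3 := mul_le_mul_of_nonneg_left (hT.trans h2) hB
    have h4 := mul_le_mul_of_nonneg_right hBα (Nat.cast_nonneg (α := ℝ) (cand x α S u).card)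
    linarith

/-- The error between a remaining vertex and a cluster `{u} ∪ T_u`. -/
theorem sum_cross_le {u v : V} (hB : 0 ≤ B) (hBα : 1 ≤ B * (α / 2)) (hα0 : 0 < α)
    (hB2 : 1 ≤ B * (1 - 2 * α))
    (hT : ∑ w ∈ cand x α S u, x.dist u w < α * ((cand x α S u).card : ℝ) / 2)
    (hv : α < x.dist u v) :
    ∑ w ∈ {u} ∪ cand x α S u, (if E.Adj v w then (1 : ℝ) else 0)
      ≤ B * ∑ w ∈ {u} ∪ cand x α S u, edgeErr E x.dist v w := by
  have hC : ∀ w ∈ {u} ∪ cand x α S u, x.dist u w ≤ α := fun w => dist_le_of_mem_cluster hα0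
  -- If `v` is far from `u`, every edge into the cluster has length at least `1 - 2α`. Otherwise
  -- each pair, whatever its label, has error above `α - x_uw`, and the average of `x_uw` over the
  -- cluster is at most `α/2`.
  rcases le_or_gt (1 - α) (x.dist u v) with hfar | hnear
  · rw [mul_sum]
    refine sum_le_sum fun w hw => ?_
    by_cases ha : E.Adj v w
    · have h1 : 1 - 2 * α ≤ x.dist v w := by
        have := hC w hw
        have := x.dist_le_add' u v w
        linarith
      simp only [edgeErr, ha, ha.ne, if_true, if_false]
      nlinarith
    · have := mul_nonneg hB (edgeErr_nonneg (E := E) x v w)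
      simpa [ha] using this
  · have hu : u ∉ cand x α S u := fun h => (mem_cand.1 h).1.1 rfl
    have hsum : 0 ≤ ∑ w ∈ {u} ∪ cand x α S u, (α / 2 - x.dist u w) := by
      rw [singleton_union, sum_insert hu, x.self_eq_zero, sum_sub_distrib, sum_const, nsmul_eq_mul]
      linarith
    calc ∑ w ∈ {u} ∪ cand x α S u, (if E.Adj v w then (1 : ℝ) else 0)
        ≤ ∑ w ∈ {u} ∪ cand x α S u,
            (B * edgeErr E x.dist v w - B * (α / 2 - x.dist u w)) := by
          refine sum_le_sum fun w hw => ?_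
          have hvw : v ≠ w := by
            rintro rfl
            exact absurd (hC v hw) (not_le.2 hv)
          by_cases ha : E.Adj v w
          · have := x.dist_le_add' u v w
            simp only [edgeErr, ha, hvw, if_true, if_false]
            nlinarith
          · have := x.triangle' u v w
            simp only [edgeErr, ha, hvw, if_false]
            rw [← mul_sub]
            exact mul_nonneg hB (by linarith)
      _ ≤ B * ∑ w ∈ {u} ∪ cand x α S u, edgeErr E x.dist v w := by
          rw [sum_sub_distrib, ← mul_sum, ← mul_sum]
          linarith [mul_nonneg hB hsum]

/-- The error at a member of a cluster `{u} ∪ T_u`, up to the `+` edges of length at most `δ` that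
leave the cluster. -/
theorem edgeErr_cluster_le {u v w : V} (hB : 0 ≤ B) (hBδ : 1 ≤ B * δ)
    (hB2 : 1 ≤ B * (1 - 2 * α)) (hα0 : 0 < α) (hv : v ∈ {u} ∪ cand x α S u) :
    edgeErr E (fun _ w => if w ∈ {u} ∪ cand x α S u then 0 else 1) v w
      ≤ B * edgeErr E x.dist v w
        + (if w ∉ {u} ∪ cand x α S u ∧ x.dist v w ≤ δ then 1 else 0) := by
  have hC : ∀ w ∈ {u} ∪ cand x α S u, x.dist u w ≤ α := fun w => dist_le_of_mem_cluster hα0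
  have hnn := mul_nonneg hB (edgeErr_nonneg (E := E) x v w)
  by_cases hw : w ∈ {u} ∪ cand x α S u
  · rw [if_neg (fun h => h.1 hw), add_zero]
    have h1 : x.dist v w ≤ 2 * α := by
      have := x.triangle' u v w
      have := hC v hv
      have := hC w hw
      linarith
    by_cases hvw : v = w
    · simp [edgeErr, hvw]
    by_cases ha : E.Adj v w
    · refine le_trans (le_of_eq ?_) hnn
      simp only [edgeErr, hvw, ha, hw, if_true, if_false]
    · simp only [edgeErr, hvw, ha, hw, if_true, if_false]
      nlinarith
  · by_cases hd : x.dist v w ≤ δ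
    · rw [if_pos ⟨hw, hd⟩]
      have : edgeErr E (fun _ w => if w ∈ {u} ∪ cand x α S u then 0 else 1) v w ≤ 1 := by
        refine edgeErr_le_one ?_ ?_ <;> split_ifs <;> norm_num
      linarith
    · rw [if_neg (fun h => hd h.2), add_zero]
      by_cases hvw : v = w
      · simp [edgeErr, hvw]
      by_cases ha : E.Adj v w
      · simp only [edgeErr, hvw, ha, hw, if_true, if_false]
        nlinarith
      · refine le_trans (le_of_eq ?_) hnn
        simp only [edgeErr, hvw, ha, hw, if_false, sub_self]

/-- This is where maximality of the pivot enters: it sits between the inclusions `cand x δ S v ⊆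
T*_v` and `T*_u ⊆ T_u`. -/
theorem card_cand_le_of_isPivot {u v : V} (hδγ : δ ≤ γ) (hγα : γ ≤ α) (hp : IsPivot x γ S u)
    (hv : v ∈ S) : ((cand x δ S v).card : ℝ) ≤ (cand x α S u).card := by
  have h1 := card_le_card (cand_mono (x := x) hδγ (subset_refl S) v)
  have h2 := card_le_card (cand_mono (x := x) hγα (subset_refl S) u)
  exact_mod_cast h1.trans ((hp.2 v hv).trans h2)

theorem card_le_sum_edgeErr_of_singleton {u v : V} (hα : α ≤ 1 / 2) (hρ : 0 ≤ ρ)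
    (hρδ : 1 ≤ ρ * (α / 2 - δ))
    (hT : α * ((cand x α S u).card : ℝ) / 2 ≤ ∑ w ∈ cand x α S u, x.dist u w)
    (huv : x.dist u v ≤ δ) :
    ((cand x α S u).card : ℝ) ≤ ρ * ∑ w ∈ S, edgeErr E x.dist v w := by
  have hsub : cand x α S u ⊆ S := fun w hw => (mem_cand.1 hw).1.2
  have h1 : ∑ w ∈ cand x α S u, (x.dist u w - δ) ≤ ∑ w ∈ S, edgeErr E x.dist v w := by
    refine (sum_le_sum fun w hw => ?_).trans
      (sum_le_sum_of_subset_of_nonneg hsub fun w _ _ => edgeErr_nonneg x v w)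
    have := dist_sub_dist_le_edgeErr (E := E) x (v := v) ((mem_cand.1 hw).2.trans hα)
    linarith
  rw [sum_sub_distrib, sum_const, nsmul_eq_mul] at h1
  have h2 := mul_le_mul_of_nonneg_right hρδ (Nat.cast_nonneg (α := ℝ) (cand x α S u).card)
  have h3 : (α / 2 - δ) * ((cand x α S u).card : ℝ) ≤ ∑ w ∈ S, edgeErr E x.dist v w := by linarith
  have h4 := mul_le_mul_of_nonneg_left h3 hρ
  linarith

theorem card_le_sum_edgeErr_of_cluster {u v : V} (hα : α ≤ 1 / 2) (hρ : 0 ≤ ρ)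
    (hρδ : 1 ≤ ρ * (α / 2 - δ))
    (hT : ∑ w ∈ cand x α S u, x.dist u w < α * ((cand x α S u).card : ℝ) / 2)
    (huv : α - δ ≤ x.dist u v) (huv' : x.dist u v ≤ α) :
    ((cand x α S u).card : ℝ) ≤ ρ * ∑ w ∈ S, edgeErr E x.dist v w := by
  have hsub : cand x α S u ⊆ S := fun w hw => (mem_cand.1 hw).1.2
  have h1 : ∑ w ∈ cand x α S u, (α - δ - x.dist u w) ≤ ∑ w ∈ S, edgeErr E x.dist v w := by
    refine (sum_le_sum fun w hw => ?_).trans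
      (sum_le_sum_of_subset_of_nonneg hsub fun w _ _ => edgeErr_nonneg x v w)
    have := dist_sub_dist_le_edgeErr' (E := E) x (w := w) (huv'.trans hα)
    linarith
  rw [sum_sub_distrib, sum_const, nsmul_eq_mul] at h1
  have h2 := mul_le_mul_of_nonneg_right hρδ (Nat.cast_nonneg (α := ℝ) (cand x α S u).card)
  have h3 : (α / 2 - δ) * ((cand x α S u).card : ℝ) ≤ ∑ w ∈ S, edgeErr E x.dist v w := by linarith
  have h4 := mul_le_mul_of_nonneg_left h3 hρ
  linarith

/-- The error at a member of a cluster `{u} ∪ T_u`. -/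
theorem sum_cluster_le {u v : V} (hδγ : δ ≤ γ) (hγα : γ ≤ α) (hα : α ≤ 1 / 2) (hα0 : 0 < α)
    (hB : 0 ≤ B) (hBδ : 1 ≤ B * δ) (hB2 : 1 ≤ B * (1 - 2 * α)) (hρ : 0 ≤ ρ)
    (hρδ : 1 ≤ ρ * (α / 2 - δ)) (hp : IsPivot x γ S u)
    (hT : ∑ w ∈ cand x α S u, x.dist u w < α * ((cand x α S u).card : ℝ) / 2)
    (hv : v ∈ {u} ∪ cand x α S u) :
    ∑ w ∈ S, edgeErr E (fun _ w => if w ∈ {u} ∪ cand x α S u then 0 else 1) v w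
      ≤ (B + ρ) * ∑ w ∈ S, edgeErr E x.dist v w := by
  have h1 : ∑ w ∈ S, edgeErr E (fun _ w => if w ∈ {u} ∪ cand x α S u then 0 else 1) v w
      ≤ B * ∑ w ∈ S, edgeErr E x.dist v w
        + ({w ∈ S | w ∉ {u} ∪ cand x α S u ∧ x.dist v w ≤ δ} : Finset V).card := by
    rw [mul_sum, card_filter, Nat.cast_sum, ← sum_add_distrib]
    refine sum_le_sum fun w _ => ?_
    simpa using edgeErr_cluster_le (E := E) (w := w) hB hBδ hB2 hα0 hv
  rw [add_mul]
  refine h1.trans (add_le_add_right ?_ _)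
  -- A single short edge `vz` leaving the cluster already forces `x_uv ≥ α - δ`, since `x_uz > α`.
  rcases eq_empty_or_nonempty {w ∈ S | w ∉ {u} ∪ cand x α S u ∧ x.dist v w ≤ δ} with he | ⟨z, hz⟩
  · rw [he, card_empty, Nat.cast_zero]
    exact mul_nonneg hρ (sum_nonneg fun w _ => edgeErr_nonneg x v w)
  · obtain ⟨hzS, hzC, hvz⟩ := mem_filter.1 hz
    have hvS : v ∈ S := cluster_subset hp.1 hv
    have huz : α < x.dist u z := lt_dist_of_notMem_cluster hzS hzC
    have huv : x.dist u v ≤ α := dist_le_of_mem_cluster hα0 hv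
    have huv' : α - δ ≤ x.dist u v := by linarith [x.dist_le_add u v z]
    refine le_trans ?_ (card_le_sum_edgeErr_of_cluster hα hρ hρδ hT huv' huv)
    refine le_trans ?_ (card_cand_le_of_isPivot hδγ hγα hp hvS)
    refine Nat.cast_le.2 (card_le_card fun w hw => ?_)
    obtain ⟨hwS, hwC, hvw⟩ := mem_filter.1 hw
    refine mem_cand.2 ⟨⟨?_, hwS⟩, hvw⟩
    rintro rfl
    exact hwC hv

theorem sum_cut_cons_of_mem {C : Finset V} (hL : ∀ D ∈ L, D ⊆ S \ C) {v : V} (hv : v ∈ C) :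
    ∑ w ∈ S, edgeErr E (cut (C :: L)) v w
      = ∑ w ∈ S, edgeErr E (fun _ w => if w ∈ C then 0 else 1) v w :=
  sum_congr rfl fun _ _ => edgeErr_cut_of_mem hL hv

theorem sum_cut_cons_of_notMem {C : Finset V} (hC : C ⊆ S) (hL : ∀ D ∈ L, D ⊆ S \ C) {v : V}
    (hv : v ∉ C) :
    ∑ w ∈ S, edgeErr E (cut (C :: L)) v w
      = ∑ w ∈ S \ C, edgeErr E (cut L) v w + ∑ w ∈ C, if E.Adj v w then (1 : ℝ) else 0 := by
  rw [← sum_sdiff hC]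
  congr 1
  · exact sum_congr rfl fun w _ => edgeErr_cut_of_notMem hv w
  · exact sum_congr rfl fun w hw => edgeErr_cut_of_mem_of_notMem hL hv hw

theorem adj_le_of_lt_dist {u v : V} (hB : 0 ≤ B) (hBδ : 1 ≤ B * δ) (h : δ < x.dist u v) :
    (if E.Adj v u then (1 : ℝ) else 0) ≤ B * edgeErr E x.dist v u := by
  by_cases ha : E.Adj v u
  · rw [x.symm] at h
    simp only [edgeErr, ha, ha.ne, if_true, if_false]
    nlinarith
  · rw [if_neg ha]
    exact mul_nonneg hB (edgeErr_nonneg x v u)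

/-- The cardinality is a budget for future singleton pivots within `δ` of `v`: each costs at most
`1` and leaves the set it counts. -/
theorem Run.sum_cut_le_add_card (hδγ : δ ≤ γ) (hγα : γ ≤ α) (hα : α ≤ 1 / 2) (hα0 : 0 < α)
    (hB : 0 ≤ B) (hBδ : 1 ≤ B * δ) (hBα : 1 ≤ B * (α / 2)) (hB2 : 1 ≤ B * (1 - 2 * α))
    (hρ : 0 ≤ ρ) (hρδ : 1 ≤ ρ * (α / 2 - δ)) (h : Run x α γ S L) :
    ∀ v ∈ S, ∑ w ∈ S, edgeErr E (cut L) v w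
      ≤ (B + ρ) * ∑ w ∈ S, edgeErr E x.dist v w + (cand x δ S v).card := by
  induction h with
  | halt => simp
  | type1 S L p hp hT rest ih =>
    intro v hv
    have hpS : {p} ⊆ S := singleton_subset_iff.2 hp.1
    by_cases hvp : v ∈ ({p} : Finset V)
    · rw [sum_cut_cons_of_mem rest.subset hvp]
      rw [mem_singleton.1 hvp]
      have h1 := sum_singleton_le (E := E) hα hB hBα hT
      have h2 := mul_nonneg hρ (sum_nonneg fun w (_ : w ∈ S) => edgeErr_nonneg (E := E) x p w)
      have h3 : (0 : ℝ) ≤ (cand x δ S p).card := Nat.cast_nonneg _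
      linarith
    · rw [sum_cut_cons_of_notMem hpS rest.subset hvp, ← sum_sdiff hpS, sum_singleton,
        sum_singleton]
      have h1 := ih v (mem_sdiff.2 ⟨hv, hvp⟩)
      have h2 := edgeErr_nonneg (E := E) x v p
      have h3 := mul_nonneg hρ h2
      rcases le_or_gt (x.dist p v) δ with hd | hd
      · have h4 : ((cand x δ (S \ {p}) v).card : ℝ) + 1 ≤ (cand x δ S v).card := by
          have : cand x δ (S \ {p}) v ⊂ cand x δ S v := by
            refine (ssubset_iff_of_subset (cand_mono le_rfl sdiff_subset v)).2 ⟨p, ?_, ?_⟩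
            · refine mem_cand.2 ⟨⟨?_, hp.1⟩, by rwa [x.symm]⟩
              rintro rfl
              exact hvp (mem_singleton_self _)
            · simp [mem_cand]
          exact_mod_cast card_lt_card this
        have h5 : (if E.Adj v p then (1 : ℝ) else 0) ≤ 1 := by split_ifs <;> norm_num
        have h6 := mul_nonneg hB h2
        linarith
      · have h4 := adj_le_of_lt_dist (E := E) hB hBδ hd
        have h5 : ((cand x δ (S \ {p}) v).card : ℝ) ≤ (cand x δ S v).card :=
          Nat.cast_le.2 (card_le_card (cand_mono le_rfl sdiff_subset v))
        linarith
  | type2 S L p hp hT rest ih =>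
    intro v hv
    have hpS : {p} ∪ cand x α S p ⊆ S := cluster_subset hp.1
    by_cases hvp : v ∈ {p} ∪ cand x α S p
    · rw [sum_cut_cons_of_mem rest.subset hvp]
      have h1 := sum_cluster_le (E := E) hδγ hγα hα hα0 hB hBδ hB2 hρ hρδ hp hT hvp
      have h3 : (0 : ℝ) ≤ (cand x δ S v).card := Nat.cast_nonneg _
      linarith
    · rw [sum_cut_cons_of_notMem hpS rest.subset hvp, ← sum_sdiff hpS]
      have h1 := ih v (mem_sdiff.2 ⟨hv, hvp⟩)
      have h2 := sum_cross_le (E := E) hB hBα hα0 hB2 hT (lt_dist_of_notMem_cluster hv hvp)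
      have h3 := mul_nonneg hρ
        (sum_nonneg fun w (_ : w ∈ {p} ∪ cand x α S p) => edgeErr_nonneg (E := E) x v w)
      have h5 : ((cand x δ (S \ ({p} ∪ cand x α S p)) v).card : ℝ) ≤ (cand x δ S v).card :=
        Nat.cast_le.2 (card_le_card (cand_mono le_rfl sdiff_subset v))
      linarith

/-- The second `ρ` pays off the budget of `Run.sum_cut_le_add_card`, which is invoked only at the
first singleton pivot within `δ` of `v`. -/
theorem Run.sum_cut_le (hδγ : δ ≤ γ) (hγα : γ ≤ α) (hα : α ≤ 1 / 2) (hα0 : 0 < α)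
    (hB : 0 ≤ B) (hBδ : 1 ≤ B * δ) (hBα : 1 ≤ B * (α / 2)) (hB2 : 1 ≤ B * (1 - 2 * α))
    (hρ : 0 ≤ ρ) (hρδ : 1 ≤ ρ * (α / 2 - δ)) (h : Run x α γ S L) :
    ∀ v ∈ S, ∑ w ∈ S, edgeErr E (cut L) v w
      ≤ (B + 2 * ρ) * ∑ w ∈ S, edgeErr E x.dist v w := by
  induction h with
  | halt => simp
  | type1 S L p hp hT rest ih =>
    intro v hv
    have hpS : {p} ⊆ S := singleton_subset_iff.2 hp.1
    by_cases hvp : v ∈ ({p} : Finset V)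
    · rw [sum_cut_cons_of_mem rest.subset hvp]
      rw [mem_singleton.1 hvp]
      have h1 := sum_singleton_le (E := E) hα hB hBα hT
      have h2 := mul_nonneg hρ (sum_nonneg fun w (_ : w ∈ S) => edgeErr_nonneg (E := E) x p w)
      linarith
    -- A near pivot ends the induction for `v`: its `T_p` bounds the whole budget at once. A far
    -- pivot costs only the edge `vp`, paid by its own length.
    · rcases le_or_gt (x.dist p v) δ with hd | hd
      · have h1 := Run.sum_cut_le_add_card (E := E) hδγ hγα hα hα0 hB hBδ hBα hB2 hρ hρδ
          (Run.type1 S L p hp hT rest) v hv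
        have h2 := card_cand_le_of_isPivot hδγ hγα hp hv
        have h3 := card_le_sum_edgeErr_of_singleton (E := E) hα hρ hρδ hT hd
        linarith
      · rw [sum_cut_cons_of_notMem hpS rest.subset hvp, ← sum_sdiff hpS, sum_singleton,
          sum_singleton]
        have h1 := ih v (mem_sdiff.2 ⟨hv, hvp⟩)
        have h3 := mul_nonneg hρ (edgeErr_nonneg (E := E) x v p)
        have h4 := adj_le_of_lt_dist (E := E) hB hBδ hd
        linarith
  | type2 S L p hp hT rest ih =>
    intro v hv
    have hpS : {p} ∪ cand x α S p ⊆ S := cluster_subset hp.1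
    by_cases hvp : v ∈ {p} ∪ cand x α S p
    · rw [sum_cut_cons_of_mem rest.subset hvp]
      have h1 := sum_cluster_le (E := E) hδγ hγα hα hα0 hB hBδ hB2 hρ hρδ hp hT hvp
      have h2 := mul_nonneg hρ (sum_nonneg fun w (_ : w ∈ S) => edgeErr_nonneg (E := E) x v w)
      linarith
    · rw [sum_cut_cons_of_notMem hpS rest.subset hvp, ← sum_sdiff hpS]
      have h1 := ih v (mem_sdiff.2 ⟨hv, hvp⟩)
      have h2 := sum_cross_le (E := E) hB hBα hα0 hB2 hT (lt_dist_of_notMem_cluster hv hvp)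
      have h3 := mul_nonneg hρ
        (sum_nonneg fun w (_ : w ∈ {p} ∪ cand x α S p) => edgeErr_nonneg (E := E) x v w)
      linarith

end Charging

/-! ### Choice of constants and conclusion. -/

theorem errVec_nonneg [Fintype V] [DecidableEq V] (E : SimpleGraph V) [DecidableRel E.Adj]
    (x : FracClustering V) (v : V) : 0 ≤ errVec E x v := by
  rw [errVec_eq_sum]
  exact sum_nonneg fun w _ => edgeErr_nonneg x v w

/-- An approximation ratio of the rounding algorithm with thresholds `α, γ`. -/
noncomputable def ratio (α γ : ℝ) : ℝ :=
  (1 / (1 - 2 * α) + 1 / min γ (α / 4)) + 2 * (1 / (α / 2 - min γ (α / 4)))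

theorem Run.errVec_le [Fintype V] [DecidableEq V] {E : SimpleGraph V} [DecidableRel E.Adj]
    {x : FracClustering V} {α γ : ℝ} (hγ : 0 < γ) (hγα : γ < α) (hα : α < 1 / 2)
    {L : List (Finset V)} (h : Run x α γ univ L) (v : V) :
    ∑ w, edgeErr E (cut L) v w ≤ ratio α γ * errVec E x v := by
  have hα0 : 0 < α := hγ.trans hγα
  -- Since `γ` may exceed `α/2`, capping `δ` at `α/4` keeps `α/2 - δ` positive.
  have hδ : 0 < min γ (α / 4) := lt_min hγ (by linarith)
  have hδ4 : min γ (α / 4) ≤ α / 4 := min_le_right _ _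
  have h2 : 0 < 1 - 2 * α := by linarith
  have h3 : 0 < α / 2 - min γ (α / 4) := by linarith
  have hBδ : 1 ≤ (1 / (1 - 2 * α) + 1 / min γ (α / 4)) * min γ (α / 4) := by
    rw [add_mul, one_div_mul_cancel hδ.ne']
    have : 0 < 1 / (1 - 2 * α) * min γ (α / 4) := by positivity
    linarith
  rw [errVec_eq_sum]
  refine h.sum_cut_le (δ := min γ (α / 4)) (min_le_left _ _) hγα.le hα.le hα0 (by positivity) hBδ
    (hBδ.trans ?_) ?_ (by positivity) (one_div_mul_cancel h3.ne').ge v (mem_univ v)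
  · gcongr
    linarith
  · rw [add_mul, one_div_mul_cancel h2.ne']
    have : 0 < 1 / min γ (α / 4) * (1 - 2 * α) := by positivity
    linarith

theorem ratio_pos {α γ : ℝ} (hγ : 0 < γ) (hγα : γ < α) (hα : α < 1 / 2) : 0 < ratio α γ := by
  have hδ : 0 < min γ (α / 4) := lt_min hγ (by linarith)
  have hδ4 : min γ (α / 4) ≤ α / 4 := min_le_right _ _
  have h2 : 0 < 1 - 2 * α := by linarith
  have h3 : 0 < α / 2 - min γ (α / 4) := by linarith
  unfold ratio
  positivity

end CorrClust

theorem theorem1 :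
    ∃ c : ℝ → ℝ → ℝ,
      (∀ α γ : ℝ, 0 < γ → γ < α → α < 1 / 2 →
        0 < c α γ ∧
        ∀ (V : Type u) [Fintype V] [DecidableEq V] (E : SimpleGraph V) [DecidableRel E.Adj]
          (x : CorrClust.FracClustering V),
          (∃ L : List (Finset V), CorrClust.Run x α γ Finset.univ L) ∧
          ∀ L : List (Finset V), CorrClust.Run x α γ Finset.univ L →
            ∃ C : Finpartition (Finset.univ : Finset V),
              C.parts.val = (L : Multiset (Finset V)) ∧
              (∀ v : V, CorrClust.errVec E (CorrClust.ofPartition C) v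
                ≤ c α γ * CorrClust.errVec E x v) ∧
              ∀ f : (V → ℝ) → ℝ, CorrClust.GoodObjective f →
                f (CorrClust.errVec E (CorrClust.ofPartition C))
                  ≤ c α γ * f (CorrClust.errVec E x)) ∧
      c 0.465744 0.0887449 ≤ 48 := by
  refine ⟨CorrClust.ratio, fun α γ hγ hγα hα => ⟨CorrClust.ratio_pos hγ hγα hα,
    fun V _ _ E _ x => ⟨CorrClust.exists_run x α γ univ, fun L hL => ?_⟩⟩, ?_⟩
  · obtain ⟨C, hCL, hC⟩ := hL.exists_finpartition
    have hle : ∀ v : V, CorrClust.errVec E (CorrClust.ofPartition C) v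
        ≤ CorrClust.ratio α γ * CorrClust.errVec E x v := by
      intro v
      rw [CorrClust.errVec_eq_sum, hC]
      exact hL.errVec_le hγ hγα hα v
    have hc := (CorrClust.ratio_pos hγ hγα hα).le
    refine ⟨C, hCL, hle, fun f hf => ?_⟩
    refine (hf.mono _ (CorrClust.ratio α γ • CorrClust.errVec E x)
      (CorrClust.errVec_nonneg E _) (fun v => ?_) hle).trans
      (hf.scale _ hc _ (CorrClust.errVec_nonneg E x))
    exact mul_nonneg hc (CorrClust.errVec_nonneg E x v)
  -- Here `γ < α/4`, so `δ = γ`, and the ratio is about `39.7`.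
  · norm_num [CorrClust.ratio, min_def]
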